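/- **Definitions.** Let $V$ be a set and let $f:\{0,1\}^{2^k}\to V$ be a Boolean or pseudo-Boolean function, $k\ge 0$. Fix a variable ordering $\mathit{Ord}$, i.e. a permutation of the $2^k$ variables. *BDD.* The quasi-reduced BDD of $f$ is the ordered, rooted, layered decision diagram in which no ply is skipped: every non-leaf node at depth $d<2^k$ reads the $d$-th variable in the ordering and has a $0$-successor and a $1$-successor (possibly equal) at depth $d+1$, the nodes at depth $2^k$ are the leaves and carry values in $V$, all nodes are reachable from the root, distinct leaves carry distinct values, and distinct nodes of equal depth differ in at least one successor. *CFLOBDD.* A mock-CFLOBDD at level $k$ consists of finitely many groupings at levels $0,\dots,k$, with exactly one (the head) at level $k$ and every other one called by some grouping one level higher. Each grouping has one entry vertex and a non-empty ordered list of exit vertices. A level-$0$ grouping is a fork (two exits; the branch for $0$ goes to the first and the branch for $1$ to the second) or a don't-care grouping (one exit, reached by both branches). A grouping $g$ at level $l\ge1$ also has an ordered list of middle vertices; one A-call edge from its entry vertex to a level-$(l-1)$ grouping, with one return edge from each exit vertex of that callee to a middle vertex of $g$; and for each middle vertex one B-call edge to a level-$(l-1)$ grouping, with one return edge from each exit vertex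 of that callee to an exit vertex of $g$. The return tuple of a call edge lists the indices (from $1$) of the targets of its return edges, in the order of the callee's exit vertices. Each exit vertex of the head has a value edge to an element of $V$. A word $w\in\{0,1\}^{2^l}$ is interpreted in a level-$l$ grouping by interpreting its first half in the A-callee, following the matching A-return edge to a middle vertex, interpreting the second half in the B-callee of that vertex, and following the matching B-return edge to an exit vertex; a level-$0$ grouping reads one bit. In a mock-CFLOBDD the value edge of the head then gives the result. A CFLOBDD is a mock-CFLOBDD such that: 1. every exit vertex of a grouping at level $\ge1$ is the target of some return edge; 2. each A-return tuple is $[1,2,\dots,r]$, where $r$ is both the number of exit vertices of the A-callee and the number of middle vertices; 3. each B-return tuple has no repetitions, and if $n$ is the largest index in the B-return tuples of the preceding middle vertices of the same grouping ($n=0$ if there are none), then its subsequence of entries larger than $n$ is $[n+1,\dots,n+m]$ for some $m\ge 0$; 4. no two distinct groupings head equal (isomorphic) substructures; 5. two B-connections of a grouping whose callees head equal substructures have different return tuples; 6. the value edges lead to distinct values. **Theorem.** There is an absolute constant $K$ such that for all $k\ge0$, all sets $V$, all $f:\{0,1\}^{2^k}\to V$ and all variable orderings $\mathit{Ord}$: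 if $B$ is the quasi-reduced BDD of $f$ and $C$ is a level-$k$ CFLOBDD for $f$, both with the ordering $\mathit{Ord}$, then the number $|E(C)|$ of edges of $C$ satisfies $$|E(C)|\le K\,|B|^3,$$ that is, $|E(C)|=\mathcal O(|B|^3)$. Here $|E(C)|$ counts all edges: call edges, return edges, the two branches of each level-$0$ grouping, and the value edges. The bound holds both when $|B|$ is the number of nodes of $B$ (leaves included) and when $|B|$ is the number of edges of $B$. -/

import Mathlib

universe u

/-! ### Ordered BDDs without ply-skipping -/

/-- An ordered (multi-terminal) binary decision diagram over `n` Boolean variables in which no ply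
is skipped: the nodes are arranged by depth `0, …, n`, there is one root, a node at depth `d < n`
reads the `d`-th variable of the ordering and has a false- and a true-successor at depth `d + 1`,
and the nodes at depth `n` are the leaves, labelled by terminal values in `V`.
Every node is reachable from the root. -/
structure OBDD (V : Type u) (n : ℕ) where
  /-- `Node d` is the set of nodes at depth `d`. -/
  Node : ℕ → Type
  nodeFintype : ∀ d, Fintype (Node d)
  isEmpty_of_lt : ∀ d, n < d → IsEmpty (Node d)
  root : Node 0
  eq_root : ∀ u : Node 0, u = root
  succ : ∀ d, d < n → Node d → Bool → Node (d + 1)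
  reachable : ∀ d (h : d < n) (v : Node (d + 1)), ∃ (u : Node d) (b : Bool), succ d h u b = v
  value : Node n → V

attribute [instance] OBDD.nodeFintype

namespace OBDD

variable {V : Type u} {n : ℕ}

/-- Maximal sub-DAGs are shared: distinct leaves carry distinct values, and distinct nodes at the
same depth differ in at least one successor. (Don't-care nodes are kept.) -/
structure IsQuasiReduced (B : OBDD V n) : Prop where
  value_injective : Function.Injective B.value
  succ_injective : ∀ d (h : d < n) (u v : B.Node d),
    (∀ b, B.succ d h u b = B.succ d h v b) → u = v

/-- The node at depth `d` reached from the root when the values `w 0, w 1, …` are read. -/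
def nodeAt (B : OBDD V n) (w : Fin n → Bool) : (d : ℕ) → d ≤ n → B.Node d
  | 0, _ => B.root
  | d + 1, h => B.succ d h (nodeAt B w d (Nat.le_of_succ_le h)) (w ⟨d, h⟩)

/-- The interpretation of the word `w`: the value of the leaf reached by reading all of `w`. -/
def eval (B : OBDD V n) (w : Fin n → Bool) : V :=
  B.value (B.nodeAt w n le_rfl)

/-- `B` is a diagram for `f` with the variable ordering `ord`: the `i`-th variable that is read is
`x_{ord i}`. -/
def Represents (B : OBDD V n) (ord : Equiv.Perm (Fin n)) (f : (Fin n → Bool) → V) : Prop :=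
  ∀ α : Fin n → Bool, B.eval (fun i => α (ord i)) = f α

/-- The number of nodes, leaves included. -/
def numNodes (B : OBDD V n) : ℕ :=
  ∑ d ∈ Finset.range (n + 1), Fintype.card (B.Node d)

/-- The number of edges: two for every node that is not a leaf. -/
def numEdges (B : OBDD V n) : ℕ :=
  ∑ d ∈ Finset.range n, 2 * Fintype.card (B.Node d)

end OBDD

/-! ### CFLOBDDs -/

/-- The two kinds of groupings at level 0. -/
inductive Level0Kind where
  | fork
  | dontCare

namespace Level0Kind

/-- A fork grouping has two exit vertices, a don't-care grouping has one. -/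
def numExits : Level0Kind → ℕ
  | fork => 2
  | dontCare => 1

/-- The exit vertex to which the left (`false`) or right (`true`) branch leads. -/
def branch : (κ : Level0Kind) → Bool → Fin κ.numExits
  | fork, false => ⟨0, Nat.zero_lt_two⟩
  | fork, true => ⟨1, Nat.one_lt_two⟩
  | dontCare, _ => ⟨0, Nat.one_pos⟩

end Level0Kind

/-- The inner part of a grouping with `e` exit vertices whose calls lead to groupings in `G`
(where `numExits h` is the number of exit vertices of `h`): its middle vertices, the A-connection
(the A-call edge, and for each exit vertex of the callee the matching return edge to a middle
vertex), and for each middle vertex a B-connection (the B-call edge, and for each exit vertex of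
the callee the matching return edge to an exit vertex).
Middle and exit vertices are given with their fixed order, as elements of `Fin _`. -/
structure Connections (G : Type) (numExits : G → ℕ) (e : ℕ) where
  numMid : ℕ
  aCallee : G
  aReturn : Fin (numExits aCallee) → Fin numMid
  bCallee : Fin numMid → G
  bReturn : (m : Fin numMid) → Fin (numExits (bCallee m)) → Fin e

namespace Connections

variable {G : Type} {numExits : G → ℕ} {e : ℕ}

/-- The return tuple of the A-call edge, with indices starting at 1. -/
def aTuple (c : Connections G numExits e) : List ℕ :=
  List.ofFn fun i => (c.aReturn i : ℕ) + 1

/-- The return tuple of the B-call edge at the middle vertex `m`, with indices starting at 1. -/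
def bTuple (c : Connections G numExits e) (m : Fin c.numMid) : List ℕ :=
  List.ofFn fun i => (c.bReturn m i : ℕ) + 1

/-- The largest index (starting at 1) of an exit vertex that occurs in the return tuples of the
B-connections that precede the one at `m`; it is `0` if there is none. -/
def lastExitBefore (c : Connections G numExits e) (m : Fin c.numMid) : ℕ :=
  (Finset.univ.filter fun m' => m' < m).sup fun m' => (c.bTuple m').toFinset.sup id

end Connections

/-- A mock-CFLOBDD at level `k` with terminal values in `V`. -/
structure MockCFLOBDD (V : Type u) (k : ℕ) where
  /-- `Grouping l` is the set of groupings at level `l`. -/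
  Grouping : ℕ → Type
  groupingFintype : ∀ l, Fintype (Grouping l)
  isEmpty_of_lt : ∀ l, k < l → IsEmpty (Grouping l)
  numExits : (l : ℕ) → Grouping l → ℕ
  numExits_pos : ∀ l (g : Grouping l), 0 < numExits l g
  /-- A grouping at level `0` is a fork grouping or a don't-care grouping. -/
  kind : Grouping 0 → Level0Kind
  numExits_zero : ∀ g : Grouping 0, numExits 0 g = (kind g).numExits
  /-- The middle vertices and the connections of a grouping at a level `l + 1`. -/
  conn : (l : ℕ) → (g : Grouping (l + 1)) →
    Connections (Grouping l) (numExits l) (numExits (l + 1) g)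
  /-- The head is the only grouping at level `k`. -/
  head : Grouping k
  eq_head : ∀ g : Grouping k, g = head
  /-- Every grouping below level `k` is called by a grouping one level up, so that all groupings
  are connected to the head. -/
  called : ∀ l, l < k → ∀ h : Grouping l, ∃ g : Grouping (l + 1),
    (conn l g).aCallee = h ∨ ∃ m, (conn l g).bCallee m = h
  /-- The value edges. -/
  value : Fin (numExits k head) → V

attribute [instance] MockCFLOBDD.groupingFintype

/-- The first half of a word of length `2 ^ (l + 1)`. -/
def firstHalf {l : ℕ} (w : Fin (2 ^ (l + 1)) → Bool) : Fin (2 ^ l) → Bool :=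
  fun i => w ⟨i, by have := i.isLt; rw [pow_succ]; omega⟩

/-- The second half of a word of length `2 ^ (l + 1)`. -/
def secondHalf {l : ℕ} (w : Fin (2 ^ (l + 1)) → Bool) : Fin (2 ^ l) → Bool :=
  fun i => w ⟨2 ^ l + i, by have := i.isLt; rw [pow_succ]; omega⟩

namespace MockCFLOBDD

variable {V : Type u} {k : ℕ}

/-- The exit vertex of the level-`l` grouping `g` that ends the matched path which starts at the
entry vertex of `g` and interprets the word `w` of length `2 ^ l`: at level `0` one variable is
read; at level `l + 1` the A-callee interprets the first half, the matching A-return edge leads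
to a middle vertex `m`, the B-callee of `m` interprets the second half, and the matching B-return
edge leads to an exit vertex. -/
def exitAt (C : MockCFLOBDD V k) :
    (l : ℕ) → (g : C.Grouping l) → (Fin (2 ^ l) → Bool) → Fin (C.numExits l g)
  | 0, g, w => Fin.cast (C.numExits_zero g).symm ((C.kind g).branch (w ⟨0, Nat.one_pos⟩))
  | l + 1, g, w =>
    let c := C.conn l g
    let m := c.aReturn (exitAt C l c.aCallee (firstHalf w))
    c.bReturn m (exitAt C l (c.bCallee m) (secondHalf w))

/-- The interpretation of the word `w`: the terminal value at the end of its matched path. -/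
def eval (C : MockCFLOBDD V k) (w : Fin (2 ^ k) → Bool) : V :=
  C.value (C.exitAt k C.head w)

/-- `C` is a diagram for `f` with the variable ordering `ord`: the `i`-th variable that is read is
`x_{ord i}`. -/
def Represents (C : MockCFLOBDD V k) (ord : Equiv.Perm (Fin (2 ^ k)))
    (f : (Fin (2 ^ k) → Bool) → V) : Prop :=
  ∀ α : Fin (2 ^ k) → Bool, C.eval (fun i => α (ord i)) = f α

/-- Equality of the proto-CFLOBDDs headed by two groupings at level `l`, defined inductively on
the hierarchical structure. -/
def ProtoEq (C : MockCFLOBDD V k) : (l : ℕ) → C.Grouping l → C.Grouping l → Prop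
  | 0, g, g' => C.kind g = C.kind g'
  | l + 1, g, g' =>
    C.numExits (l + 1) g = C.numExits (l + 1) g' ∧
    (C.conn l g).numMid = (C.conn l g').numMid ∧
    ProtoEq C l (C.conn l g).aCallee (C.conn l g').aCallee ∧
    (C.conn l g).aTuple = (C.conn l g').aTuple ∧
    ∀ (m : Fin (C.conn l g).numMid) (m' : Fin (C.conn l g').numMid), (m : ℕ) = m' →
      ProtoEq C l ((C.conn l g).bCallee m) ((C.conn l g').bCallee m') ∧
      (C.conn l g).bTuple m = (C.conn l g').bTuple m'

/-- The structural invariants that make a mock-CFLOBDD a CFLOBDD. -/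
structure IsCFLOBDD (C : MockCFLOBDD V k) : Prop where
  /-- Every exit vertex of a grouping at level `≥ 1` is the target of some return edge. -/
  exit_used : ∀ l (g : C.Grouping (l + 1)) (x : Fin (C.numExits (l + 1) g)),
    ∃ m i, (C.conn l g).bReturn m i = x
  /-- The A-return tuple is `[1, 2, …, r]`, where the A-callee has `r` exit vertices and the
  grouping has `r` middle vertices. -/
  aTuple_eq : ∀ l (g : C.Grouping (l + 1)),
    (C.conn l g).numMid = C.numExits l (C.conn l g).aCallee ∧
    (C.conn l g).aTuple = List.range' 1 (C.conn l g).numMid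
  /-- There are no repetitions in a B-return tuple. -/
  bTuple_nodup : ∀ l (g : C.Grouping (l + 1)) (m : Fin (C.conn l g).numMid),
    ((C.conn l g).bTuple m).Nodup
  /-- Each B-return tuple compactly extends the preceding ones: if `n` is the largest exit index
  used before, its subsequence `R` of entries greater than `n` is `[n + 1, …, n + length R]`. -/
  bTuple_compact : ∀ l (g : C.Grouping (l + 1)) (m : Fin (C.conn l g).numMid),
    let n := (C.conn l g).lastExitBefore m
    let R := ((C.conn l g).bTuple m).filter fun x => n < x
    R = List.range' (n + 1) R.length
  /-- There are no two separate instances of equal proto-CFLOBDDs. -/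
  eq_of_protoEq : ∀ l (g g' : C.Grouping l), C.ProtoEq l g g' → g = g'
  /-- Two B-connections of a grouping that call equal proto-CFLOBDDs have different return
  tuples. -/
  bConn_ne : ∀ l (g : C.Grouping (l + 1)) (m m' : Fin (C.conn l g).numMid), m ≠ m' →
    C.ProtoEq l ((C.conn l g).bCallee m) ((C.conn l g).bCallee m') →
    (C.conn l g).bTuple m ≠ (C.conn l g).bTuple m'
  /-- The value tuple maps the exit vertices of the head to distinct values. -/
  value_injective : Function.Injective C.value

/-- The number of edges that belong to a grouping. At level `0`: the left and the right branch.
At level `l + 1`: the A-call edge, the A-return edges, the B-call edges (one for each middle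
vertex) and the B-return edges. -/
def groupingEdges (C : MockCFLOBDD V k) : (l : ℕ) → C.Grouping l → ℕ
  | 0, _ => 2
  | l + 1, g =>
    1 + C.numExits l (C.conn l g).aCallee + (C.conn l g).numMid +
      ∑ m, C.numExits l ((C.conn l g).bCallee m)

/-- The total number of edges: those of all groupings, and the value edges of the head. -/
def numEdges (C : MockCFLOBDD V k) : ℕ :=
  (∑ l ∈ Finset.range (k + 1), ∑ g : C.Grouping l, C.groupingEdges l g) + C.numExits k C.head

end MockCFLOBDD

/-! Every grouping of $C$ at level $l$ is entered, on some matched path, after a prefix `α` of some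
length $a$ has been read, and its exit vertices then correspond to the residual functions of $f$
after $2^l$ further letters (`Realizes`, `exists_realizes`). A residual function is determined by
the BDD node reached (`residualFn_wordEval_eq`), which gives two bounds. The number of exits is at
most the number $b_{a+2^l}$ of nodes at depth $a+2^l$. By canonicity (`eq_of_ker`: the kernel of its
interpretation determines a grouping), the groupings of one level also inject into the BDD nodes,
each going to a node at its depth $a$ (`sum_grouping_le`).

A level-$(l+1)$ grouping has at most $b_{a+2^l}$ middle vertices, each with at most $|B|$ B-return
edges, hence at most $4\,b_{a+2^l}|B|$ edges. The total over all levels is at most $4|B|\sum_a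
b_a\sum_l b_{a+2^l}$. For fixed $a$ the depths $a+2^l$ are distinct, so the inner sum is at most
$|B|$: no factor $k$ arises and the bound is cubic. -/

/-! ### Infinite words and residual functions -/

/-- The word that agrees with `w` on its first `d` letters and continues with `γ`. -/
def splice (d : ℕ) (w γ : ℕ → Bool) : ℕ → Bool :=
  fun i => if i < d then w i else γ (i - d)

theorem splice_of_lt {d i : ℕ} (w γ : ℕ → Bool) (h : i < d) : splice d w γ i = w i := if_pos h

theorem splice_add (d i : ℕ) (w γ : ℕ → Bool) : splice d w γ (d + i) = γ i := by
  simp [splice]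

theorem splice_zero (w γ : ℕ → Bool) : splice 0 w γ = γ := by
  funext i; simp [splice]

theorem splice_drop (d : ℕ) (w : ℕ → Bool) : splice d w (fun i => w (d + i)) = w := by
  funext i
  unfold splice
  split_ifs with h
  · rfl
  · exact congrArg w (by omega)

theorem splice_splice (a b : ℕ) (w γ δ : ℕ → Bool) :
    splice a w (splice b γ δ) = splice (a + b) (splice a w γ) δ := by
  funext i
  unfold splice
  split_ifs <;> first | rfl | omega | (congr 1; omega)

/-- What is left of `F` after the first `d` letters of `w` have been read. -/
def residualFn {V : Type u} (F : (ℕ → Bool) → V) (d : ℕ) (w : ℕ → Bool) : (ℕ → Bool) → V :=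
  fun γ => F (splice d w γ)

theorem residualFn_residualFn {V : Type u} (F : (ℕ → Bool) → V) (a b : ℕ) (w γ : ℕ → Bool) :
    residualFn (residualFn F a w) b γ = residualFn F (a + b) (splice a w γ) := by
  funext δ
  simp only [residualFn, splice_splice]

/-! ### Lists that compactly extend an initial segment -/

/-- Used to compare B-return tuples: where an entry is not already known to agree, both entries are
new, and new entries are numbered consecutively in order of appearance. The start `s` is general so
that the induction can advance it. -/
theorem eq_of_filter_eq_range' {n : ℕ} : ∀ {s : ℕ} {L L' : List ℕ},
    List.Forall₂ (fun x y => x = y ∨ (n < x ∧ n < y)) L L' →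
    (∃ r, (L.filter fun x => n < x) = List.range' s r) →
    (∃ r, (L'.filter fun x => n < x) = List.range' s r) → L = L'
  | _, _, _, .nil, _, _ => rfl
  | s, x :: L, y :: L', .cons hxy hL, ⟨r, hr⟩, ⟨r', hr'⟩ => by
    by_cases hx : n < x
    · have hy : n < y := by rcases hxy with rfl | h; exacts [hx, h.2]
      rw [List.filter_cons_of_pos (by simpa using hx)] at hr
      rw [List.filter_cons_of_pos (by simpa using hy)] at hr'
      cases r with
      | zero => simp at hr
      | succ r =>
        cases r' with
        | zero => simp at hr'
        | succ r' =>
          rw [List.range'_succ, List.cons.injEq] at hr hr'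
          rw [hr.1, hr'.1, eq_of_filter_eq_range' hL ⟨r, hr.2⟩ ⟨r', hr'.2⟩]
    · obtain rfl : x = y := by rcases hxy with h | h; exacts [h, absurd h.1 hx]
      rw [List.filter_cons_of_neg (by simpa using hx)] at hr hr'
      rw [eq_of_filter_eq_range' hL ⟨r, hr⟩ ⟨r', hr'⟩]

/-! ### Matched paths in a mock-CFLOBDD, on infinite words -/

namespace MockCFLOBDD

variable {V : Type u} {k : ℕ} (C : MockCFLOBDD V k)

/-- The exit vertex of `g` at which the interpretation of the first `2 ^ l` letters of `w` ends. -/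
def exit (l : ℕ) (g : C.Grouping l) (w : ℕ → Bool) : Fin (C.numExits l g) :=
  C.exitAt l g fun i => w i

/-- The middle vertex of `g` to which the first half of `w` leads. -/
def mid (l : ℕ) (g : C.Grouping (l + 1)) (w : ℕ → Bool) : Fin (C.conn l g).numMid :=
  (C.conn l g).aReturn (C.exit l (C.conn l g).aCallee w)

/-- The exit vertex of `g` that is reached from the middle vertex `m` by `w`. -/
def bExit (l : ℕ) (g : C.Grouping (l + 1)) (m : Fin (C.conn l g).numMid) (w : ℕ → Bool) :
    Fin (C.numExits (l + 1) g) :=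
  (C.conn l g).bReturn m (C.exit l ((C.conn l g).bCallee m) w)

theorem exit_congr {l : ℕ} (g : C.Grouping l) {w w' : ℕ → Bool} (h : ∀ i < 2 ^ l, w i = w' i) :
    C.exit l g w = C.exit l g w' := by
  unfold exit
  congr 1
  funext i
  exact h i i.isLt

theorem exit_splice_self {l : ℕ} (g : C.Grouping l) (w γ : ℕ → Bool) :
    C.exit l g (splice (2 ^ l) w γ) = C.exit l g w :=
  C.exit_congr g fun _ hi => splice_of_lt w γ hi

theorem exit_succ {l : ℕ} (g : C.Grouping (l + 1)) (w : ℕ → Bool) :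
    C.exit (l + 1) g w = C.bExit l g (C.mid l g w) fun i => w (2 ^ l + i) := rfl

theorem exit_splice {l : ℕ} (g : C.Grouping (l + 1)) (w γ : ℕ → Bool) :
    C.exit (l + 1) g (splice (2 ^ l) w γ) = C.bExit l g (C.mid l g w) γ := by
  rw [exit_succ]
  simp only [splice_add]
  rw [mid, exit_splice_self, mid]

theorem protoEq_refl : ∀ (l : ℕ) (g : C.Grouping l), C.ProtoEq l g g
  | 0, _ => rfl
  | l + 1, g => by
    refine ⟨rfl, rfl, protoEq_refl l _, rfl, fun m m' h => ?_⟩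
    obtain rfl : m = m' := Fin.ext h
    exact ⟨protoEq_refl l _, rfl⟩

/-! ### Reachability of vertices and return tuples -/

namespace IsCFLOBDD

variable {C}

theorem aReturn_val (hC : C.IsCFLOBDD) {l : ℕ} (g : C.Grouping (l + 1))
    (i : Fin (C.numExits l (C.conn l g).aCallee)) : ((C.conn l g).aReturn i : ℕ) = i := by
  have h := congrArg (fun L => L[(i : ℕ)]?) (hC.aTuple_eq l g).2
  have hi : (i : ℕ) < (C.conn l g).numMid := i.isLt.trans_eq (hC.aTuple_eq l g).1.symm
  simp [Connections.aTuple, hi] at h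
  omega

theorem bReturn_injective (hC : C.IsCFLOBDD) {l : ℕ} (g : C.Grouping (l + 1))
    (m : Fin (C.conn l g).numMid) : Function.Injective ((C.conn l g).bReturn m) := by
  have h := List.nodup_ofFn.1 (hC.bTuple_nodup l g m)
  exact fun i j hij => h (by simp only [hij])

theorem mid_val (hC : C.IsCFLOBDD) {l : ℕ} (g : C.Grouping (l + 1)) (w : ℕ → Bool) :
    (C.mid l g w : ℕ) = C.exit l (C.conn l g).aCallee w :=
  hC.aReturn_val g _

theorem mid_eq_iff (hC : C.IsCFLOBDD) {l : ℕ} (g : C.Grouping (l + 1)) (w w' : ℕ → Bool) :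
    C.mid l g w = C.mid l g w' ↔
      C.exit l (C.conn l g).aCallee w = C.exit l (C.conn l g).aCallee w' := by
  rw [Fin.ext_iff, hC.mid_val, hC.mid_val, Fin.ext_iff]

/-- An exit vertex is the target of some B-return edge. A word leading to its middle vertex,
followed by one leading to the right exit of the B-callee, reaches it. -/
theorem exit_surjective (hC : C.IsCFLOBDD) : ∀ (l : ℕ) (g : C.Grouping l),
    Function.Surjective (C.exit l g)
  | 0, g => by
    have key : ∀ (κ : Level0Kind) (y : Fin κ.numExits), ∃ b, κ.branch b = y := by
      rintro (_ | _) y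
      · match y with
        | ⟨0, _⟩ => exact ⟨false, rfl⟩
        | ⟨1, _⟩ => exact ⟨true, rfl⟩
      · match y with
        | ⟨0, _⟩ => exact ⟨false, rfl⟩
    intro x
    obtain ⟨b, hb⟩ := key (C.kind g) (Fin.cast (C.numExits_zero g) x)
    refine ⟨fun _ => b, ?_⟩
    simp [exit, exitAt, hb]
  | l + 1, g => by
    intro x
    obtain ⟨m, i, rfl⟩ := hC.exit_used l g x
    obtain ⟨w, hw⟩ := exit_surjective hC l (C.conn l g).aCallee
      ⟨m, m.isLt.trans_eq (hC.aTuple_eq l g).1⟩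
    obtain ⟨γ, rfl⟩ := exit_surjective hC l _ i
    refine ⟨splice (2 ^ l) w γ, ?_⟩
    have hm : C.mid l g w = m := Fin.ext (by rw [hC.mid_val, hw])
    rw [exit_splice, hm, bExit]

theorem mid_surjective (hC : C.IsCFLOBDD) {l : ℕ} (g : C.Grouping (l + 1)) :
    Function.Surjective (C.mid l g) := by
  intro m
  obtain ⟨w, hw⟩ := hC.exit_surjective l (C.conn l g).aCallee
    ⟨m, m.isLt.trans_eq (hC.aTuple_eq l g).1⟩
  exact ⟨w, Fin.ext (by rw [hC.mid_val, hw])⟩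

theorem bExit_eq_iff (hC : C.IsCFLOBDD) {l : ℕ} (g : C.Grouping (l + 1))
    (m : Fin (C.conn l g).numMid) (w w' : ℕ → Bool) :
    C.bExit l g m w = C.bExit l g m w' ↔
      C.exit l ((C.conn l g).bCallee m) w = C.exit l ((C.conn l g).bCallee m) w' :=
  (hC.bReturn_injective g m).eq_iff

theorem mem_bTuple_iff (hC : C.IsCFLOBDD) {l : ℕ} (g : C.Grouping (l + 1))
    (m : Fin (C.conn l g).numMid) (x : ℕ) :
    x ∈ (C.conn l g).bTuple m ↔ ∃ γ, (C.bExit l g m γ : ℕ) + 1 = x := by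
  simp only [Connections.bTuple, List.mem_ofFn, bExit]
  exact ⟨fun ⟨i, hi⟩ => by
    obtain ⟨γ, rfl⟩ := hC.exit_surjective l _ i
    exact ⟨γ, hi⟩, fun ⟨γ, h⟩ => ⟨_, h⟩⟩

/-- Every tuple position is an exit of the callee, hence reached by a word; with a common callee,
one word names the same position in both tuples. -/
theorem forall₂_bTuple_of_bExit (hC : C.IsCFLOBDD) {l : ℕ} {g g' : C.Grouping (l + 1)}
    (m : Fin (C.conn l g).numMid) (m' : Fin (C.conn l g').numMid)
    (hcallee : (C.conn l g).bCallee m = (C.conn l g').bCallee m')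
    (R : ℕ → ℕ → Prop) (h : ∀ γ, R ((C.bExit l g m γ : ℕ) + 1) ((C.bExit l g' m' γ : ℕ) + 1)) :
    List.Forall₂ R ((C.conn l g).bTuple m) ((C.conn l g').bTuple m') := by
  have hlen : C.numExits l ((C.conn l g).bCallee m) = C.numExits l ((C.conn l g').bCallee m') := by
    rw [hcallee]
  rw [List.forall₂_iff_get]
  refine ⟨by simp [Connections.bTuple, hlen], fun i hi hi' => ?_⟩
  simp only [Connections.bTuple, List.length_ofFn] at hi hi'
  obtain ⟨γ, hγ⟩ := hC.exit_surjective l _ ⟨i, hi⟩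
  have hγ' : C.exit l ((C.conn l g').bCallee m') γ = ⟨i, hi'⟩ := by
    have : ∀ h' (hh : (C.conn l g).bCallee m = h'), (C.exit l h' γ : ℕ) = i := by
      rintro _ rfl; rw [hγ]
    exact Fin.ext (this _ hcallee)
  have := h γ
  rw [bExit, bExit, hγ, hγ'] at this
  simpa [Connections.bTuple] using this

/-- Compactness leaves no gaps: every index up to the largest one used so far has itself been used.
-/
theorem mem_lastExitBefore (hC : C.IsCFLOBDD) {l : ℕ} (g : C.Grouping (l + 1)) (j : ℕ) :
    ∀ (m : Fin (C.conn l g).numMid), (m : ℕ) = j → ∀ x, 0 < x →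
      x ≤ (C.conn l g).lastExitBefore m → ∃ m' < m, x ∈ (C.conn l g).bTuple m' := by
  induction j using Nat.strong_induction_on with
  | _ j ih =>
    intro m hm x hx hxm
    obtain ⟨m', hm', hx'⟩ := (Finset.le_sup_iff hx).1 hxm
    obtain ⟨y, hy, hxy⟩ := (Finset.le_sup_iff hx).1 hx'
    simp only [Finset.mem_filter, Finset.mem_univ, true_and] at hm'
    simp only [List.mem_toFinset, id] at hy hxy
    by_cases hlt : x ≤ (C.conn l g).lastExitBefore m'
    · obtain ⟨m'', h1, h2⟩ := ih m' (hm ▸ hm') m' rfl x hx hlt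
      exact ⟨m'', h1.trans hm', h2⟩
    · refine ⟨m', hm', ?_⟩
      have hc := hC.bTuple_compact l g m'
      simp only at hc
      have hyR : y ∈ ((C.conn l g).bTuple m').filter
          fun x => (C.conn l g).lastExitBefore m' < x := by
        simp only [List.mem_filter, decide_eq_true_eq]
        exact ⟨hy, by omega⟩
      have hxR : x ∈ ((C.conn l g).bTuple m').filter
          fun x => (C.conn l g).lastExitBefore m' < x := by
        rw [hc, List.mem_range'_1] at hyR ⊢
        omega
      exact (List.mem_filter.1 hxR).1

theorem lastExitBefore_congr {l : ℕ} {g g' : C.Grouping (l + 1)}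
    (hmid : (C.conn l g).numMid = (C.conn l g').numMid)
    (m : Fin (C.conn l g).numMid) (m' : Fin (C.conn l g').numMid) (hm : (m : ℕ) = m')
    (h : ∀ (p : Fin (C.conn l g).numMid) (p' : Fin (C.conn l g').numMid), (p : ℕ) = p' → p < m →
      (C.conn l g).bTuple p = (C.conn l g').bTuple p') :
    (C.conn l g).lastExitBefore m = (C.conn l g').lastExitBefore m' := by
  apply le_antisymm
  · refine Finset.sup_le fun p hp => ?_
    simp only [Finset.mem_filter, Finset.mem_univ, true_and] at hp
    rw [h p (Fin.cast hmid p) rfl hp]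
    exact Finset.le_sup (f := fun m' => ((C.conn l g').bTuple m').toFinset.sup id)
      (by simp [Fin.lt_def, ← hm, hp])
  · refine Finset.sup_le fun p hp => ?_
    simp only [Finset.mem_filter, Finset.mem_univ, true_and] at hp
    have hp' : Fin.cast hmid.symm p < m := by rw [Fin.lt_def, hm]; exact hp
    rw [← h (Fin.cast hmid.symm p) p rfl hp']
    exact Finset.le_sup (f := fun m' => ((C.conn l g).bTuple m').toFinset.sup id)
      (by simp [hp'])

/-! ### Canonicity of groupings -/

/-- Middle vertices are determined by the functions that their B-connections compute, provided that
groupings one level down are determined by the kernels of their interpretations. -/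
theorem mid_injective_of (hC : C.IsCFLOBDD) {l : ℕ}
    (canon : ∀ g g' : C.Grouping l,
      (∀ w w', C.exit l g w = C.exit l g w' ↔ C.exit l g' w = C.exit l g' w') → g = g')
    (g : C.Grouping (l + 1)) (m m' : Fin (C.conn l g).numMid)
    (h : ∀ γ, C.bExit l g m γ = C.bExit l g m' γ) : m = m' := by
  by_contra hne
  -- B-returns are injective, so equal B-functions give callees with equal kernels; equal tuples
  -- then contradict `bConn_ne`.
  have hcallee : (C.conn l g).bCallee m = (C.conn l g).bCallee m' :=
    canon _ _ fun w w' => by rw [← hC.bExit_eq_iff, ← hC.bExit_eq_iff, h, h]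
  refine hC.bConn_ne l g m m' hne (hcallee ▸ C.protoEq_refl l _) ?_
  rw [← List.forall₂_eq_eq_eq]
  exact hC.forall₂_bTuple_of_bExit m m' hcallee _ fun γ => by rw [h]

theorem numExits_le_of_ker (hC : C.IsCFLOBDD) {l : ℕ} {g g' : C.Grouping l}
    (h : ∀ w w', C.exit l g w = C.exit l g w' ↔ C.exit l g' w = C.exit l g' w') :
    C.numExits l g ≤ C.numExits l g' := by
  choose ω hω using hC.exit_surjective l g
  have : Function.Injective fun x => C.exit l g' (ω x) := fun x y hxy => by
    rw [← hω x, ← hω y]; exact (h _ _).2 hxy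
  simpa using Fintype.card_le_of_injective _ this

/-- Canonicity: a grouping is determined by the kernel of its interpretation. -/
theorem eq_of_ker (hC : C.IsCFLOBDD) : ∀ (l : ℕ) (g g' : C.Grouping l),
    (∀ w w', C.exit l g w = C.exit l g w' ↔ C.exit l g' w = C.exit l g' w') → g = g'
  | 0, g, g', h => by
    apply hC.eq_of_protoEq
    -- At level 0 the number of exits alone separates forks from don't-cares.
    have h1 := hC.numExits_le_of_ker h
    have h2 := hC.numExits_le_of_ker fun w w' => (h w w').symm
    rw [C.numExits_zero, C.numExits_zero] at h1 h2
    change C.kind g = C.kind g'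
    revert h1 h2
    cases C.kind g <;> cases C.kind g' <;> simp [Level0Kind.numExits]
  | l + 1, g, g', h => by
    have canon := eq_of_ker hC l
    -- The kernel of the A-callee can be read off from that of `g`, because distinct middle vertices
    -- compute distinct functions.
    have hA : ∀ (g : C.Grouping (l + 1)) (w w' : ℕ → Bool),
        C.exit l (C.conn l g).aCallee w = C.exit l (C.conn l g).aCallee w' ↔
          ∀ γ, C.exit (l + 1) g (splice (2 ^ l) w γ) = C.exit (l + 1) g (splice (2 ^ l) w' γ) := by
      intro g w w'
      simp only [exit_splice]
      rw [← hC.mid_eq_iff]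
      exact ⟨fun e γ => by rw [e], hC.mid_injective_of canon g _ _⟩
    have hac : (C.conn l g).aCallee = (C.conn l g').aCallee := canon _ _ fun w w' => by
      rw [hA, hA]
      exact forall_congr' fun γ => h _ _
    have hmid : (C.conn l g).numMid = (C.conn l g').numMid := by
      rw [(hC.aTuple_eq l g).1, (hC.aTuple_eq l g').1, hac]
    have hreach : ∀ w, (C.mid l g w : ℕ) = C.mid l g' w := by
      intro w
      rw [hC.mid_val, hC.mid_val, hac]
    have hpair : ∀ (m : Fin (C.conn l g).numMid) (m' : Fin (C.conn l g').numMid), (m : ℕ) = m' →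
        ∃ w, C.mid l g w = m ∧ C.mid l g' w = m' := by
      intro m m' hm
      obtain ⟨w, rfl⟩ := hC.mid_surjective g m
      exact ⟨w, rfl, Fin.ext (by rw [← hreach, hm])⟩
    have hB : ∀ (m : Fin (C.conn l g).numMid) (m' : Fin (C.conn l g').numMid), (m : ℕ) = m' →
        ∀ (p : Fin (C.conn l g).numMid) (p' : Fin (C.conn l g').numMid), (p : ℕ) = p' →
        ∀ γ δ, C.bExit l g m γ = C.bExit l g p δ ↔ C.bExit l g' m' γ = C.bExit l g' p' δ := by
      intro m m' hm p p' hp γ δ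
      obtain ⟨w, rfl, rfl⟩ := hpair m m' hm
      obtain ⟨v, rfl, rfl⟩ := hpair p p' hp
      simp only [← exit_splice]
      exact h _ _
    have hbc : ∀ (m : Fin (C.conn l g).numMid) (m' : Fin (C.conn l g').numMid), (m : ℕ) = m' →
        (C.conn l g).bCallee m = (C.conn l g').bCallee m' := fun m m' hm =>
      canon _ _ fun w w' => by
        rw [← hC.bExit_eq_iff, ← hC.bExit_eq_iff]
        exact hB m m' hm m m' hm w w'
    -- The kernel fixes exits only up to renaming; the numbering is recovered one middle vertex at a
    -- time.
    have htuple : ∀ (j : ℕ) (m : Fin (C.conn l g).numMid) (m' : Fin (C.conn l g').numMid),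
        (m : ℕ) = m' → (m : ℕ) = j → (C.conn l g).bTuple m = (C.conn l g').bTuple m' := by
      intro j
      induction j using Nat.strong_induction_on with
      | _ j ih =>
        intro m m' hm hj
        have hprev : ∀ (p : Fin (C.conn l g).numMid) (p' : Fin (C.conn l g').numMid),
            (p : ℕ) = p' → p < m → (C.conn l g).bTuple p = (C.conn l g').bTuple p' :=
          fun p p' hp hlt => ih p (hj ▸ hlt) p p' hp rfl
        have hlast := lastExitBefore_congr hmid m m' hm hprev
        have hprevExit : ∀ (p : Fin (C.conn l g).numMid) (p' : Fin (C.conn l g').numMid),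
            (p : ℕ) = p' → p < m → ∀ δ, (C.bExit l g p δ : ℕ) = C.bExit l g' p' δ := by
          intro p p' hp hlt δ
          have hcl := hbc p p' hp
          have hv := hprev p p' hp hlt
          have hval : ∀ q (hq : (C.conn l g).bCallee p = q), (C.exit l q δ : ℕ) =
              C.exit l ((C.conn l g).bCallee p) δ := by rintro _ rfl; rfl
          have h1 : ((C.conn l g).bTuple p)[(C.exit l ((C.conn l g).bCallee p) δ : ℕ)]? =
              some ((C.bExit l g p δ : ℕ) + 1) := by
            simp [Connections.bTuple, bExit]
          have h2 : ((C.conn l g').bTuple p')[(C.exit l ((C.conn l g').bCallee p') δ : ℕ)]? =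
              some ((C.bExit l g' p' δ : ℕ) + 1) := by
            simp [Connections.bTuple, bExit]
          rw [hval _ hcl, ← hv, h1] at h2
          simpa using h2
        refine eq_of_filter_eq_range' (n := (C.conn l g).lastExitBefore m)
          (hC.forall₂_bTuple_of_bExit m m' (hbc m m' hm) _ fun γ => ?_)
          ⟨_, hC.bTuple_compact l g m⟩ ⟨_, hlast ▸ hC.bTuple_compact l g' m'⟩
        -- An old exit was already reached from an earlier middle vertex `p`; `hB` carries this
        -- coincidence to the other grouping, where the earlier exits have the same index.
        by_cases h1 : (C.bExit l g m γ : ℕ) + 1 ≤ (C.conn l g).lastExitBefore m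
        · left
          obtain ⟨p, hp, hx⟩ := hC.mem_lastExitBefore g m m rfl _ (Nat.succ_pos _) h1
          obtain ⟨δ, hδ⟩ := (hC.mem_bTuple_iff g p _).1 hx
          have e : C.bExit l g m γ = C.bExit l g p δ := Fin.ext (by omega)
          have e' := (hB m m' hm p (Fin.cast hmid p) rfl γ δ).1 e
          rw [e, e', hprevExit p (Fin.cast hmid p) rfl hp]
        by_cases h2 : (C.bExit l g' m' γ : ℕ) + 1 ≤ (C.conn l g).lastExitBefore m
        · left
          obtain ⟨p', hp', hx⟩ := hC.mem_lastExitBefore g' m' m' rfl _ (Nat.succ_pos _) (hlast ▸ h2)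
          obtain ⟨δ, hδ⟩ := (hC.mem_bTuple_iff g' p' _).1 hx
          have e : C.bExit l g' m' γ = C.bExit l g' p' δ := Fin.ext (by omega)
          have e' := (hB m m' hm (Fin.cast hmid.symm p') p' rfl γ δ).2 e
          rw [e, e', hprevExit (Fin.cast hmid.symm p') p' rfl (by rw [Fin.lt_def, hm]; exact hp')]
        · right
          omega
    apply hC.eq_of_protoEq
    refine ⟨le_antisymm (hC.numExits_le_of_ker h)
      (hC.numExits_le_of_ker fun w w' => (h w w').symm), hmid, hac ▸ C.protoEq_refl l _, ?_, ?_⟩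
    · rw [(hC.aTuple_eq l g).2, (hC.aTuple_eq l g').2, hmid]
    · exact fun m m' hm => ⟨hbc m m' hm ▸ C.protoEq_refl l _, htuple m m m' hm rfl⟩

end IsCFLOBDD

end MockCFLOBDD

/-! ### BDD nodes and residual functions -/

namespace OBDD

variable {V : Type u} {n : ℕ} (B : OBDD V n)

theorem nodeAt_congr {w w' : Fin n → Bool} : ∀ {d : ℕ} (h : d ≤ n),
    (∀ i : Fin n, (i : ℕ) < d → w i = w' i) → B.nodeAt w d h = B.nodeAt w' d h
  | 0, _, _ => rfl
  | d + 1, h, hw => by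
    simp only [nodeAt]
    rw [nodeAt_congr _ fun i hi => hw i (hi.trans d.lt_succ_self), hw ⟨d, h⟩ d.lt_succ_self]

theorem nodeAt_congr_of_le {w w' : Fin n → Bool} {d : ℕ} (hd : d ≤ n)
    (hnode : B.nodeAt w d hd = B.nodeAt w' d hd) (hw : ∀ i : Fin n, d ≤ i → w i = w' i)
    (e : ℕ) (he : e ≤ n) (hde : d ≤ e) : B.nodeAt w e he = B.nodeAt w' e he := by
  induction e, hde using Nat.le_induction with
  | base => exact hnode
  | succ e hde ih =>
    simp only [nodeAt]
    rw [ih (Nat.le_of_succ_le he), hw ⟨e, he⟩ hde]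

/-- The function on infinite words that a diagram computes from their first `n` letters. -/
def wordEval (w : ℕ → Bool) : V := B.eval fun i => w i

/-- The node at depth `d` to which the first `d` letters of `w` lead. -/
def node (w : ℕ → Bool) (d : ℕ) (h : d ≤ n) : B.Node d := B.nodeAt (fun i => w i) d h

theorem residualFn_wordEval_eq {d : ℕ} (hd : d ≤ n) {w w' : ℕ → Bool}
    (h : B.node w d hd = B.node w' d hd) :
    residualFn B.wordEval d w = residualFn B.wordEval d w' := by
  funext γ
  have key : ∀ v : ℕ → Bool, B.node (splice d v γ) d hd = B.node v d hd := fun v =>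
    B.nodeAt_congr hd fun i hi => splice_of_lt v γ hi
  refine congrArg B.value (B.nodeAt_congr_of_le hd ?_ (fun i hi => ?_) n le_rfl hd)
  · exact (key w).trans (h.trans (key w').symm)
  · simp [splice, hi.not_gt]

theorem card_le_numNodes (d : ℕ) : Fintype.card (B.Node d) ≤ B.numNodes := by
  rcases le_or_gt d n with h | h
  · exact Finset.single_le_sum (f := fun d => Fintype.card (B.Node d)) (fun _ _ => Nat.zero_le _)
      (Finset.mem_range.2 (Nat.lt_succ_of_le h))
  · have := B.isEmpty_of_lt d h
    simp

/-- Arbitrary `s` is allowed because the depths $a+2^l$ summed over later may exceed `n`, where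
there are no nodes. -/
theorem sum_card_le_numNodes (s : Finset ℕ) :
    ∑ d ∈ s, Fintype.card (B.Node d) ≤ B.numNodes := by
  rw [← Finset.sum_filter_add_sum_filter_not s (fun d => d ∈ Finset.range (n + 1))]
  have hz : ∑ d ∈ s.filter (fun d => ¬ d ∈ Finset.range (n + 1)), Fintype.card (B.Node d) = 0 := by
    refine Finset.sum_eq_zero fun d hd => ?_
    have hd' : n < d := by simpa using (Finset.mem_filter.1 hd).2
    have := B.isEmpty_of_lt d hd'
    simp
  rw [hz, add_zero]
  exact Finset.sum_le_sum_of_subset fun d hd => (Finset.mem_filter.1 hd).2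

theorem numNodes_pos : 0 < B.numNodes :=
  (Fintype.card_pos_iff.2 ⟨B.root⟩).trans_le (B.card_le_numNodes 0)

/-- Only the leaves have no outgoing edges, and reachability makes them at most twice as many as the
nodes of the preceding ply. For `n = 0` there is a node but no edge. -/
theorem numNodes_le_two_mul_numEdges (hn : 0 < n) : B.numNodes ≤ 2 * B.numEdges := by
  obtain ⟨p, rfl⟩ : ∃ p, n = p + 1 := ⟨n - 1, by omega⟩
  have hlast : Fintype.card (B.Node (p + 1)) ≤ 2 * Fintype.card (B.Node p) := by
    have hs : Function.Surjective
        fun x : B.Node p × Bool => B.succ p p.lt_succ_self x.1 x.2 := fun v => by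
      obtain ⟨u, b, h⟩ := B.reachable p p.lt_succ_self v
      exact ⟨(u, b), h⟩
    simpa [mul_comm] using Fintype.card_le_of_surjective _ hs
  unfold numNodes numEdges
  rw [Finset.sum_range_succ, ← Finset.mul_sum]
  have : Fintype.card (B.Node p) ≤ ∑ d ∈ Finset.range (p + 1), Fintype.card (B.Node d) :=
    Finset.single_le_sum (f := fun d => Fintype.card (B.Node d)) (fun _ _ => Nat.zero_le _)
      (Finset.self_mem_range_succ p)
  omega

end OBDD

/-! ### Groupings as sets of residual functions, and the edge count -/

namespace MockCFLOBDD

variable {V : Type u} {k : ℕ} (C : MockCFLOBDD V k)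

/-- The exit vertices of `g` correspond to the residual functions of `F` that are obtained by
reading `2 ^ l` further letters after the first `a` letters of `α`. -/
def Realizes (F : (ℕ → Bool) → V) (l : ℕ) (g : C.Grouping l) (a : ℕ) (α : ℕ → Bool) : Prop :=
  a + 2 ^ l ≤ 2 ^ k ∧ ∀ w w', C.exit l g w = C.exit l g w' ↔
    residualFn F (a + 2 ^ l) (splice a α w) = residualFn F (a + 2 ^ l) (splice a α w')

namespace IsCFLOBDD

variable {C} {F : (ℕ → Bool) → V}

theorem realizes_head (hC : C.IsCFLOBDD) (hF : ∀ w, F w = C.eval fun i => w i) (α : ℕ → Bool) :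
    C.Realizes F k C.head 0 α := by
  have hF' : ∀ w, F w = C.value (C.exit k C.head w) := hF
  refine ⟨by simp, fun w w' => ?_⟩
  simp only [splice_zero, zero_add]
  rw [funext_iff]
  simp only [residualFn, hF', exit_splice_self]
  exact ⟨fun h _ => by rw [h], fun h => hC.value_injective (h w)⟩

/-- Exits of the A-callee are the middle vertices of `g`. By canonicity two of these coincide as
soon as all continuations lead to the same exits of `g`, which `h` expresses through residual
functions. -/
theorem realizes_aCallee (hC : C.IsCFLOBDD) {l : ℕ} {g : C.Grouping (l + 1)} {a : ℕ}
    {α : ℕ → Bool} (h : C.Realizes F (l + 1) g a α) :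
    C.Realizes F l (C.conn l g).aCallee a α := by
  have hpow : a + 2 ^ (l + 1) = a + 2 ^ l + 2 ^ l := by rw [pow_succ]; omega
  have hle := h.1
  have hpos := Nat.two_pow_pos l
  refine ⟨by omega, fun w w' => ⟨fun hw => funext fun γ => ?_, fun hw => ?_⟩⟩
  · have hx : C.exit (l + 1) g (splice (2 ^ l) w γ) = C.exit (l + 1) g (splice (2 ^ l) w' γ) := by
      rw [exit_splice, exit_splice, (hC.mid_eq_iff g w w').2 hw]
    -- The argument `γ` is cut after $2^l$ letters: the first part completes the word read by `g`,
    -- the rest feeds the residual function.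
    have key : ∀ v : ℕ → Bool, residualFn F (a + 2 ^ l) (splice a α v) γ =
        residualFn F (a + 2 ^ (l + 1)) (splice a α (splice (2 ^ l) v γ))
          fun i => γ (2 ^ l + i) := by
      intro v
      simp only [residualFn]
      rw [splice_splice a (2 ^ l), hpow, ← splice_splice (a + 2 ^ l) (2 ^ l), splice_drop]
    rw [key, key, (h.2 _ _).1 hx]
  · rw [← hC.mid_eq_iff]
    refine hC.mid_injective_of (hC.eq_of_ker l) g _ _ fun γ => ?_
    rw [← exit_splice, ← exit_splice, h.2, hpow]
    simp only [splice_splice a (2 ^ l)]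
    rw [← residualFn_residualFn F (a + 2 ^ l), hw, residualFn_residualFn]

/-- Since B-returns are injective, the B-callee inherits the kernel of `g` restricted to words that
begin with the first $2^l$ letters of `v`. -/
theorem realizes_bCallee (hC : C.IsCFLOBDD) {l : ℕ} {g : C.Grouping (l + 1)} {a : ℕ}
    {α : ℕ → Bool} (h : C.Realizes F (l + 1) g a α) (v : ℕ → Bool) :
    C.Realizes F l ((C.conn l g).bCallee (C.mid l g v)) (a + 2 ^ l) (splice a α v) := by
  have hpow : a + 2 ^ (l + 1) = a + 2 ^ l + 2 ^ l := by rw [pow_succ]; omega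
  refine ⟨by have := h.1; omega, fun w w' => ?_⟩
  rw [← hC.bExit_eq_iff, ← exit_splice, ← exit_splice, h.2, hpow]
  simp only [splice_splice a (2 ^ l)]

theorem exists_realizes (hC : C.IsCFLOBDD) (hF : ∀ w, F w = C.eval fun i => w i) {l : ℕ}
    (hl : l ≤ k) : ∀ g : C.Grouping l, ∃ a α, C.Realizes F l g a α := by
  induction hl using Nat.decreasingInduction with
  | self =>
    intro g
    rw [C.eq_head g]
    exact ⟨0, fun _ => false, hC.realizes_head hF _⟩
  | of_succ l hl ih =>
    intro h
    obtain ⟨g, hg⟩ := C.called l hl h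
    obtain ⟨a, α, hr⟩ := ih g
    rcases hg with rfl | ⟨m, rfl⟩
    · exact ⟨a, α, hC.realizes_aCallee hr⟩
    · obtain ⟨v, rfl⟩ := hC.mid_surjective g m
      exact ⟨_, _, hC.realizes_bCallee hr v⟩

variable {B : OBDD V (2 ^ k)}

theorem numExits_le_card (hC : C.IsCFLOBDD) {l : ℕ} {g : C.Grouping l} {a : ℕ} {α : ℕ → Bool}
    (h : C.Realizes B.wordEval l g a α) :
    C.numExits l g ≤ Fintype.card (B.Node (a + 2 ^ l)) := by
  choose ω hω using hC.exit_surjective l g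
  have hinj : Function.Injective fun x => B.node (splice a α (ω x)) (a + 2 ^ l) h.1 :=
    fun x y hxy => by
      rw [← hω x, ← hω y, h.2]
      exact B.residualFn_wordEval_eq h.1 hxy
  simpa using Fintype.card_le_of_injective _ hinj

theorem groupingEdges_succ_le (hC : C.IsCFLOBDD) {l : ℕ} {g : C.Grouping (l + 1)} {a : ℕ}
    {α : ℕ → Bool} (h : C.Realizes B.wordEval (l + 1) g a α) :
    C.groupingEdges (l + 1) g ≤ 4 * (Fintype.card (B.Node (a + 2 ^ l)) * B.numNodes) := by
  have hA := hC.numExits_le_card (hC.realizes_aCallee h)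
  have hpos := C.numExits_pos l (C.conn l g).aCallee
  have hmid := (hC.aTuple_eq l g).1
  have hB : ∑ m, C.numExits l ((C.conn l g).bCallee m) ≤
      Fintype.card (B.Node (a + 2 ^ l)) * B.numNodes := by
    calc ∑ m, C.numExits l ((C.conn l g).bCallee m)
        ≤ ∑ _m : Fin (C.conn l g).numMid, B.numNodes := by
          refine Finset.sum_le_sum fun m _ => ?_
          obtain ⟨v, rfl⟩ := hC.mid_surjective g m
          exact (hC.numExits_le_card (hC.realizes_bCallee h v)).trans (B.card_le_numNodes _)
      _ = (C.conn l g).numMid * B.numNodes := by simp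
      _ ≤ _ := Nat.mul_le_mul_right _ (hmid.trans_le hA)
  have hle := Nat.le_mul_of_pos_right (Fintype.card (B.Node (a + 2 ^ l))) B.numNodes_pos
  simp only [groupingEdges]
  -- Each of the four summands is at most the product; the summand 1 is covered because the A-callee
  -- has an exit.
  omega

/-- A sum over the groupings at one level is bounded by a sum over the nodes of the BDD. -/
theorem sum_grouping_le (hC : C.IsCFLOBDD) (hF : ∀ w, B.wordEval w = C.eval fun i => w i)
    {l : ℕ} (hl : l ≤ k) (f : C.Grouping l → ℕ) (φ : ℕ → ℕ)
    (hf : ∀ g a α, C.Realizes B.wordEval l g a α → f g ≤ φ a) :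
    ∑ g, f g ≤ ∑ a ∈ Finset.range (2 ^ k + 1), Fintype.card (B.Node a) * φ a := by
  classical
  choose a α h using hC.exists_realizes hF hl
  have ha : ∀ g, a g ≤ 2 ^ k := fun g => (Nat.le_add_right _ _).trans (h g).1
  -- One occurrence of each grouping is chosen. Its BDD node determines the residual function there,
  -- hence the kernel, hence the grouping.
  let ι : C.Grouping l → Σ d : Fin (2 ^ k + 1), B.Node d := fun g =>
    ⟨⟨a g, Nat.lt_succ_of_le (ha g)⟩, B.node (α g) (a g) (ha g)⟩
  have hι : Function.Injective ι := by
    intro g g' hgg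
    have hd : a g = a g' := by simpa [ι] using congrArg (fun x => (x.1 : ℕ)) hgg
    -- The depth is generalized to `b` because the two nodes live in types that are only
    -- propositionally equal.
    have key : ∀ b (hb : b ≤ 2 ^ k) (e : a g = b),
        HEq (B.node (α g) (a g) (ha g)) (B.node (α g') b hb) →
        residualFn B.wordEval (a g) (α g) = residualFn B.wordEval (a g) (α g') := by
      rintro _ hb rfl hh
      exact B.residualFn_wordEval_eq hb (eq_of_heq hh)
    have hres := key _ (ha g') hd (Sigma.mk.inj_iff.1 hgg).2
    apply hC.eq_of_ker l
    intro w w'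
    rw [(h g).2, (h g').2, ← hd]
    simp only [← residualFn_residualFn, hres]
  calc ∑ g, f g ≤ ∑ g, φ (ι g).1 := Finset.sum_le_sum fun g _ => hf g _ _ (h g)
    _ = ∑ x ∈ Finset.univ.image ι, φ x.1 := by
      rw [Finset.sum_image fun _ _ _ _ e => hι e]
    _ ≤ ∑ x : Σ d : Fin (2 ^ k + 1), B.Node d, φ x.1 :=
      Finset.sum_le_sum_of_subset (Finset.subset_univ _)
    _ = ∑ d : Fin (2 ^ k + 1), Fintype.card (B.Node d) * φ d := by
      rw [Fintype.sum_sigma]; simp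
    _ = _ := Fin.sum_univ_eq_sum_range (fun d => Fintype.card (B.Node d) * φ d) _

theorem numEdges_le (hC : C.IsCFLOBDD) (hF : ∀ w, B.wordEval w = C.eval fun i => w i) :
    C.numEdges ≤ 7 * B.numNodes ^ 3 := by
  have h0 : ∑ g : C.Grouping 0, C.groupingEdges 0 g ≤ 2 * B.numNodes := by
    refine (hC.sum_grouping_le hF k.zero_le _ (fun _ => 2) fun g _ _ _ => le_rfl).trans ?_
    rw [← Finset.sum_mul, mul_comm, OBDD.numNodes]
  have hv : C.numExits k C.head ≤ B.numNodes :=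
    (hC.numExits_le_card (hC.realizes_head hF fun _ => false)).trans (B.card_le_numNodes _)
  have hs : ∑ l ∈ Finset.range k, ∑ g : C.Grouping (l + 1), C.groupingEdges (l + 1) g ≤
      4 * B.numNodes ^ 3 := by
    calc ∑ l ∈ Finset.range k, ∑ g : C.Grouping (l + 1), C.groupingEdges (l + 1) g
        ≤ ∑ l ∈ Finset.range k, ∑ a ∈ Finset.range (2 ^ k + 1), Fintype.card (B.Node a) *
            (4 * (Fintype.card (B.Node (a + 2 ^ l)) * B.numNodes)) :=
          Finset.sum_le_sum fun l hl => hC.sum_grouping_le hF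
            (Nat.succ_le_of_lt (Finset.mem_range.1 hl)) _ _
            fun g a α h => hC.groupingEdges_succ_le h
      _ = ∑ a ∈ Finset.range (2 ^ k + 1), Fintype.card (B.Node a) * (4 *
            ((∑ l ∈ Finset.range k, Fintype.card (B.Node (a + 2 ^ l))) * B.numNodes)) := by
          rw [Finset.sum_comm]
          simp only [Finset.mul_sum, Finset.sum_mul]
      _ ≤ ∑ a ∈ Finset.range (2 ^ k + 1), Fintype.card (B.Node a) *
            (4 * (B.numNodes * B.numNodes)) := by
          gcongr with a _
          -- Distinct levels look at distinct depths, so summing over all levels costs a single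
          -- factor `B.numNodes`.
          have hinj : Function.Injective fun l : ℕ => a + 2 ^ l := fun l l' e =>
            Nat.pow_right_injective le_rfl (Nat.add_left_cancel e)
          rw [← Finset.sum_image (f := fun d => Fintype.card (B.Node d)) fun _ _ _ _ e => hinj e]
          exact B.sum_card_le_numNodes _
      _ = 4 * B.numNodes ^ 3 := by
          rw [← Finset.sum_mul, ← OBDD.numNodes]; ring
  have hcube : B.numNodes ≤ B.numNodes ^ 3 := Nat.le_self_pow (by norm_num) _
  rw [numEdges, Finset.sum_range_succ']
  -- $7 = 4 + 2 + 1$: levels at least 1, level 0, value edges.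
  omega

end IsCFLOBDD

end MockCFLOBDD

theorem mainTheorem1 :
    ∃ K : ℕ, ∀ (V : Type u) (k : ℕ) (f : (Fin (2 ^ k) → Bool) → V)
      (ord : Equiv.Perm (Fin (2 ^ k))) (B : OBDD V (2 ^ k)) (C : MockCFLOBDD V k),
      B.IsQuasiReduced → B.Represents ord f →
      C.IsCFLOBDD → C.Represents ord f →
      C.numEdges ≤ K * B.numNodes ^ 3 ∧ C.numEdges ≤ K * B.numEdges ^ 3 := by
  -- $56 = 7\cdot 2^3$, the factor $2^3$ coming from the passage from nodes to edges.
  refine ⟨56, fun V k f ord B C _ hB hC hCf => ?_⟩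
  have hF : ∀ w, B.wordEval w = C.eval fun i => w i := fun w => by
    have h1 := hB fun i => w (ord.symm i)
    have h2 := hCf fun i => w (ord.symm i)
    simp only [Equiv.symm_apply_apply] at h1 h2
    exact h1.trans h2.symm
  have h := hC.numEdges_le hF
  have hE := Nat.pow_le_pow_left (B.numNodes_le_two_mul_numEdges (Nat.two_pow_pos k)) 3
  rw [mul_pow] at hE
  constructor <;> omega
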